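/- Fix integers $1\le\alpha\le K$ and $f\ge 1$. A server broadcasts to $K$ users over an error-free shared link. The library consists of $N=f\binom{K}{\alpha}$ files $W_{i,\mathcal S}$ of $B$ bits each, where $i\in\{1,\dots,f\}$ and $\mathcal S$ runs over the $\alpha$-subsets of $\{1,\dots,K\}$. User $k$ is interested in its file demand set $\mathcal F_k=\{W_{i,\mathcal S}: k\in\mathcal S\}$, which has $|\mathcal F|=f\binom{K-1}{\alpha-1}$ files, and has a cache of $MB$ bits. Placement, made before the demands are known, is uncoded and selfish: user $k$ stores individual bits, only of files of $\mathcal F_k$. In a valid demand each user $k$ requests one file of $\mathcal F_k$. A pair $(M,R)$ is achievable if for some $B\ge 1$ there is such a placement with which, for each valid demand, the server can broadcast at most $RB$ bits, a function of the library, such that each user recovers its requested file without error from the broadcast bits and its own cache. Let $R^\star(M)=\inf\{R:(M,R)\text{ is achievable}\}$, let $\gamma=M/N$ and $\gamma_\alpha=M/|\mathcal F|=\gamma K/\alpha$, and let \[G^\star=\frac{K(1-\gamma_\alpha)}{R^\star(M)}\] be the optimal coding gain of selfish coded caching, i.e. the ratio of the load $K(1-\gamma_\alpha)$ of uncoded delivery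 with selfish caching to the optimal load. Let $\delta<1$ be fixed. For all integers $1\le\alpha\le K$ with $\alpha/K=\delta$, all $f\ge1$ and all real $M$ with $0\le M<|\mathcal F|$ (equivalently $0\le\gamma<\delta$), one has $R^\star(M)>0$ and \[G^\star\le\frac{K\gamma+1}{(K-\alpha)\gamma+1}<\frac1{1-\delta}.\] In particular the gain does not scale with $K$: for fixed $\delta$, $G^\star$ is bounded by a constant that does not depend on $K$, $\alpha$, $f$ or $M$. -/

import Mathlib

namespace SelfishCaching

/-- The library of the symmetric `(K, α, f)` file demand set (FDS) structure: the file `(i, S)` is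
the `i`-th of the `f` files in the class of the `α`-subset `S` of the set of users. -/
abbrev LibFile (K α f : ℕ) : Type := Fin f × {S : Finset (Fin K) // S.card = α}

/-- The file demand set of user `k`: the files whose class contains `k`. -/
def fds (K α f : ℕ) (k : Fin K) : Finset (LibFile K α f) :=
  Finset.univ.filter fun w => k ∈ w.2.1

/-- The number `N` of files in the library. -/
def numFiles (K α f : ℕ) : ℕ := f * K.choose α

/-- The number of files in the FDS of any single user. -/
def fdsSize (K α f : ℕ) : ℕ := f * (K - 1).choose (α - 1)

theorem card_libFile (K α f : ℕ) : Fintype.card (LibFile K α f) = numFiles K α f := by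
  simp [LibFile, numFiles]

theorem card_fds (K α f : ℕ) (hα : 1 ≤ α) (k : Fin K) :
    (fds K α f k).card = fdsSize K α f := by
  classical
  have h1 : (fds K α f k).card =
      ((Finset.univ : Finset (Fin f)) ×ˢ
        (((Finset.univ : Finset (Fin K)).erase k).powersetCard (α - 1))).card := by
    refine Finset.card_bij (fun w _ => (w.1, w.2.1.erase k)) ?_ ?_ ?_
    · rintro ⟨i, S, hS⟩ hw
      have hk : k ∈ S := by simpa [fds] using hw
      simp only [Finset.mem_product, Finset.mem_univ, true_and, Finset.mem_powersetCard]
      exact ⟨Finset.erase_subset_erase _ (Finset.subset_univ _),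
        by rw [Finset.card_erase_of_mem hk, hS]⟩
    · rintro ⟨i, S, hS⟩ hw ⟨j, T, hT⟩ hw' h
      have hk : k ∈ S := by simpa [fds] using hw
      have hk' : k ∈ T := by simpa [fds] using hw'
      simp only [Prod.mk.injEq] at h
      have hST : S = T := by
        rw [← Finset.insert_erase hk, ← Finset.insert_erase hk', h.2]
      subst hST
      simp [h.1]
    · rintro ⟨i, S⟩ h
      simp only [Finset.mem_product, Finset.mem_univ, true_and, Finset.mem_powersetCard] at h
      have hk : k ∉ S := fun hk => by simpa using h.1 hk
      refine ⟨(i, ⟨insert k S, ?_⟩), ?_, ?_⟩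
      · rw [Finset.card_insert_of_notMem hk, h.2]; omega
      · simp [fds]
      · simp [Finset.erase_insert hk]
  rw [h1]
  simp [fdsSize, Finset.card_powersetCard]

/-- A realization of the library: each file is a string of `B` bits. -/
abbrev Library (K α f B : ℕ) : Type := LibFile K α f → Fin B → Bool

/-- An uncoded and selfish cache placement, chosen before the demands are known: `cache k w` is the
set of those bit positions of the file `w` that are stored by user `k`. -/
structure Placement (K α f B : ℕ) where
  cache : Fin K → LibFile K α f → Finset (Fin B)
  selfish : ∀ k w, w ∉ fds K α f k → cache k w = ∅

/-- Each user stores at most `M * B` bits. -/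
def Placement.FitsIn {K α f B : ℕ} (Z : Placement K α f B) (M : ℝ) : Prop :=
  ∀ k, ((∑ w, (Z.cache k w).card : ℕ) : ℝ) ≤ M * B

/-- What user `k` finds in its cache when the library is `W`: the stored bits. -/
def Placement.content {K α f B : ℕ} (Z : Placement K α f B) (k : Fin K) (W : Library K α f B) :
    (w : LibFile K α f) → Z.cache k w → Bool :=
  fun w b => W w b

/-- A demand, which gives the file requested by each user, is valid if each user requests a file
of its own FDS. -/
def ValidDemand {K α f : ℕ} (d : Fin K → LibFile K α f) : Prop :=
  ∀ k, d k ∈ fds K α f k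

/-- With the placement `Z`, the demand `d` can be served by broadcasting `L` bits: there are an
encoder of the library into `L` bits and, for each user, a decoder which recovers the requested
file, whatever the library is, from the broadcast bits and the content of the user's own cache. -/
def Deliverable {K α f B : ℕ} (Z : Placement K α f B) (d : Fin K → LibFile K α f) (L : ℕ) : Prop :=
  ∃ enc : Library K α f B → (Fin L → Bool),
  ∃ dec : (k : Fin K) → (Fin L → Bool) → ((w : LibFile K α f) → Z.cache k w → Bool) →
      (Fin B → Bool),
    ∀ (W : Library K α f B) (k : Fin K), dec k (enc W) (Z.content k W) = W (d k)

/-- The memory-load pair `(M, R)` is achievable: for some file size of `B` bits there is an uncoded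
and selfish placement in caches of `M * B` bits with which each valid demand can be served by
broadcasting at most `R * B` bits. -/
def Achievable (K α f : ℕ) (M R : ℝ) : Prop :=
  ∃ B : ℕ, 0 < B ∧ ∃ Z : Placement K α f B, Z.FitsIn M ∧
    ∀ d : Fin K → LibFile K α f, ValidDemand d → ∃ L : ℕ, (L : ℝ) ≤ R * B ∧ Deliverable Z d L

/-- The optimal worst-case load `R⋆(M)` of selfish coded caching with uncoded placement. -/
noncomputable def optimalLoad (K α f : ℕ) (M : ℝ) : ℝ := sInf {R : ℝ | Achievable K α f M R}

/-- The normalized cache size `γ = M / N`. -/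
noncomputable def gam (K α f : ℕ) (M : ℝ) : ℝ := M / numFiles K α f

/-- The effective normalized cache size `γ_α`: the fraction of its own FDS that a user can store. -/
noncomputable def gamEff (K α f : ℕ) (M : ℝ) : ℝ := M / fdsSize K α f

/-- The load `K (1 - γ_α)` of uncoded delivery with selfish caching. -/
noncomputable def uncodedLoad (K α f : ℕ) (M : ℝ) : ℝ := K * (1 - gamEff K α f M)

/-- The optimal coding gain `G⋆` of selfish coded caching. -/
noncomputable def codingGain (K α f : ℕ) (M : ℝ) : ℝ := uncodedLoad K α f M / optimalLoad K α f M

end SelfishCaching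

namespace SelfishCaching

open Finset

/-! Place the users in an order `σ`, and let the user at position `j` request a file whose class is
the cyclic window of `α` users starting at `j`. The windows are distinct because `α < K`, so the
acyclic-subgraph bound applies. A requested bit counts as soon as all its holders lie strictly after
`j` in the window, before it wraps. Averaging over all orders and all `f` indices, a bit held by `t`
users contributes `loadCoeff K α t`, by symmetry (`card_perm_map_mul`) and a hockey-stick sum. This
function is convex and decreasing, and memory bounds the mean of `t` by `Kγ`, so `R ≥ loadCoeff K α
(Kγ)`. That value is the uncoded load times `((K - α)γ + 1) / (Kγ + 1)`. -/

/-! ### Acyclic-subgraph converse -/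

/-- The acyclic-subgraph bound: if the requested files are distinct, then for each order `σ` of the
users, the broadcast is at least as long as the number of requested bits that are stored neither by
their requester nor by any user before it. -/
theorem Deliverable.sum_card_le {K α f B L : ℕ} {Z : Placement K α f B}
    {d : Fin K → LibFile K α f} (h : Deliverable Z d L) (hd : Function.Injective d)
    (σ : Equiv.Perm (Fin K)) :
    ∑ j, #{b | ∀ l ≤ j, b ∉ Z.cache (σ l) (d (σ j))} ≤ L := by
  classical
  obtain ⟨enc, dec, hdec⟩ := h
  set X : Finset (Fin K × Fin B) := {p | ∀ l ≤ p.1, p.2 ∉ Z.cache (σ l) (d (σ p.1))} with hX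
  have hcard : ∑ j, #{b | ∀ l ≤ j, b ∉ Z.cache (σ l) (d (σ j))} = #X := by
    simp only [hX, card_filter, Fintype.sum_prod_type]
  -- Test libraries: the ones among the requested bits form `A`, and all other bits are zero.
  -- Injectivity of the encoder for `A ⊆ X` gives `2 ^ #X ≤ 2 ^ L`.
  let lib : Finset (Fin K × Fin B) → Library K α f B :=
    fun A w b => decide (∃ j, w = d (σ j) ∧ (j, b) ∈ A)
  have hlib : ∀ A j b, lib A (d (σ j)) b = decide ((j, b) ∈ A) := by
    intro A j b
    simp only [lib, decide_eq_decide]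
    constructor
    · rintro ⟨l, hl, hA⟩
      rwa [σ.injective (hd hl)]
    · exact fun hA => ⟨j, rfl, hA⟩
  have hinj : Set.InjOn (fun A => enc (lib A)) (X.powerset : Set (Finset (Fin K × Fin B))) := by
    intro A hA A' hA' heq
    simp only [coe_powerset, Set.mem_preimage, Set.mem_powerset_iff, coe_subset] at hA hA'
    -- Decode along the order: the bits cached at position `j` belong to earlier requests, already
    -- recovered, or lie outside `X`, where both libraries vanish.
    have key : ∀ n : ℕ, ∀ j : Fin K, j.1 = n → ∀ b, (j, b) ∈ A ↔ (j, b) ∈ A' := by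
      intro n
      induction n using Nat.strong_induction_on with
      | _ n ih =>
        rintro j rfl
        have hcont : Z.content (σ j) (lib A) = Z.content (σ j) (lib A') := by
          funext w ⟨b, hb⟩
          simp only [Placement.content]
          by_cases hw : ∃ l, w = d (σ l)
          · obtain ⟨l, rfl⟩ := hw
            rw [hlib, hlib, decide_eq_decide]
            by_cases hlj : l < j
            · exact ih l hlj l rfl b
            · have hnX : (l, b) ∉ X := fun hmem => by
                rw [hX, mem_filter] at hmem
                exact hmem.2 j (not_lt.mp hlj) hb
              exact iff_of_false (fun h => hnX (hA h)) (fun h => hnX (hA' h))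
          · simp only [lib, decide_eq_decide]
            exact iff_of_false (fun ⟨l, hl, _⟩ => hw ⟨l, hl⟩) (fun ⟨l, hl, _⟩ => hw ⟨l, hl⟩)
        intro b
        have h1 := hdec (lib A) (σ j)
        have h2 := hdec (lib A') (σ j)
        rw [hcont, show enc (lib A) = enc (lib A') from heq, h2] at h1
        have h3 := congrFun h1 b
        rw [hlib, hlib, decide_eq_decide] at h3
        exact h3.symm
    ext ⟨j, b⟩
    exact key _ j rfl b
  have hle := card_le_card_of_injOn (t := (univ : Finset (Fin L → Bool))) _
    (fun _ _ => mem_coe.2 (mem_univ _)) hinj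
  rw [card_powerset, card_univ, Fintype.card_fun, Fintype.card_bool, Fintype.card_fin] at hle
  rw [hcard]
  exact (Nat.pow_le_pow_iff_right (by norm_num)).1 hle

/-! ### Counting permutations by symmetry -/

/-- Nested pairs of finsets with the same cardinalities are related by a permutation. -/
theorem exists_perm_map_eq {ι : Type*} [Fintype ι] [DecidableEq ι] {S T S' T' : Finset ι}
    (hT : T ⊆ S) (hT' : T' ⊆ S') (hS : #S = #S') (hTc : #T = #T') :
    ∃ π : Equiv.Perm ι, S.map π.toEmbedding = S' ∧ T.map π.toEmbedding = T' := by
  -- Fibres of the membership pattern have equal sizes on both sides, so bijections between them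
  -- glue to a permutation.
  have hfib : ∀ c : Bool × Bool,
      Nonempty ({a // (decide (a ∈ S), decide (a ∈ T)) = c} ≃
        {a // (decide (a ∈ S'), decide (a ∈ T')) = c}) := by
    intro c
    rw [← Fintype.card_eq, Fintype.card_subtype, Fintype.card_subtype]
    have aux : ∀ (U V : Finset ι), V ⊆ U →
        #{a | (decide (a ∈ U), decide (a ∈ V)) = c} =
          if c.1 then (if c.2 then #V else #U - #V)
            else (if c.2 then 0 else Fintype.card ι - #U) := by
      intro U V hVU
      obtain ⟨c1, c2⟩ := c
      cases c1 <;> cases c2 <;> simp only [Prod.mk.injEq, decide_eq_true_eq, decide_eq_false_iff_not,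
        if_true, if_false, Bool.false_eq_true]
      · rw [← card_compl]
        congr 1
        ext a
        simpa using fun h h' => h (hVU h')
      · rw [card_eq_zero]
        ext a
        simpa using fun h h' => h (hVU h')
      · rw [← card_sdiff_of_subset hVU]
        congr 1
        ext a
        simp
      · congr 1
        ext a
        simpa using fun h => hVU h
    rw [aux S T hT, aux S' T' hT', hS, hTc]
  let π : Equiv.Perm ι := Equiv.ofFiberEquiv fun c => (hfib c).some
  have hπ : ∀ a, (decide (π a ∈ S'), decide (π a ∈ T')) = (decide (a ∈ S), decide (a ∈ T)) :=
    fun a => Equiv.ofFiberEquiv_map (fun c => (hfib c).some) a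
  simp only [Prod.mk.injEq, decide_eq_decide] at hπ
  refine ⟨π, ?_, ?_⟩
  · ext a
    rw [mem_map_equiv, ← (hπ _).1, Equiv.apply_symm_apply]
  · ext a
    rw [mem_map_equiv, ← (hπ _).2, Equiv.apply_symm_apply]

/-- The number of permutations that map `I` onto `S` and a part of `J` onto `T`. -/
theorem card_perm_map_mul {ι : Type*} [Fintype ι] [DecidableEq ι] {I J S T : Finset ι}
    (hJ : J ⊆ I) (hT : T ⊆ S) (hS : #S = #I) :
    #{σ : Equiv.Perm ι | I.map σ.toEmbedding = S ∧ T ⊆ J.map σ.toEmbedding} *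
      ((Fintype.card ι).choose #I * (#I).choose #T) =
        (Fintype.card ι).factorial * (#J).choose #T := by
  set c : Finset ι → Finset ι → ℕ := fun U V =>
    #{σ : Equiv.Perm ι | I.map σ.toEmbedding = U ∧ V ⊆ J.map σ.toEmbedding} with hc
  have hconst : ∀ U ∈ powersetCard #I (univ : Finset ι), ∀ V ∈ powersetCard #T U,
      c U V = c S T := by
    intro U hU V hV
    rw [mem_powersetCard] at hU hV
    obtain ⟨π, rfl, rfl⟩ := exists_perm_map_eq hT hV.1 (hS.trans hU.2.symm) hV.2.symm
    simp only [hc]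
    refine card_bij (fun σ _ => π⁻¹ * σ) ?_ (fun a _ b _ h => mul_left_cancel h) ?_
    · intro σ hσ
      simp only [mem_filter, mem_univ, true_and] at hσ ⊢
      constructor
      · ext a
        have h := Finset.ext_iff.1 hσ.1 (π a)
        rw [mem_map_equiv, mem_map_equiv, Equiv.symm_apply_apply] at h
        rw [mem_map_equiv]
        exact h
      · intro a ha
        have h := @hσ.2 (π a) (by simpa using ha)
        rw [mem_map_equiv] at h ⊢
        exact h
    · intro σ hσ
      simp only [mem_filter, mem_univ, true_and] at hσ
      refine ⟨π * σ, ?_, by simp⟩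
      simp only [mem_filter, mem_univ, true_and]
      constructor
      · rw [← hσ.1, map_map]
        rfl
      · refine (map_subset_map.2 hσ.2).trans ?_
        rw [map_map]
        rfl
  have hsum : ∑ U ∈ powersetCard #I (univ : Finset ι), ∑ V ∈ powersetCard #T U, c U V =
      c S T * ((Fintype.card ι).choose #I * (#I).choose #T) := by
    rw [sum_congr rfl fun U hU => sum_congr rfl fun V hV => hconst U hU V hV]
    rw [sum_congr rfl fun U hU => by
      rw [sum_const, card_powersetCard, (mem_powersetCard.1 hU).2]]
    rw [sum_const, card_powersetCard, card_univ]
    simp only [smul_eq_mul]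
    ring
  rw [← hsum]
  -- Double counting: each `σ` has a single `U`, the image of `I`, and the admissible `V` are the
  -- `#T`-subsets of the image of `J`.
  have hdouble : ∀ U ∈ powersetCard #I (univ : Finset ι), ∑ V ∈ powersetCard #T U, c U V =
      ∑ σ : Equiv.Perm ι, if I.map σ.toEmbedding = U then (#J).choose #T else 0 := by
    intro U _
    simp only [hc, card_filter]
    rw [sum_comm]
    refine sum_congr rfl fun σ _ => ?_
    split_ifs with hσ
    · simp only [hσ, true_and]
      rw [← card_filter, ← card_map σ.toEmbedding (s := J), ← card_powersetCard]
      congr 1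
      ext V
      simp only [mem_filter, mem_powersetCard]
      have : J.map σ.toEmbedding ⊆ U := hσ ▸ map_subset_map.2 hJ
      exact ⟨fun h => ⟨h.2, h.1.2⟩, fun h => ⟨⟨h.1.trans this, h.2⟩, h.1⟩⟩
    · simp [hσ]
  rw [sum_congr rfl hdouble, sum_comm]
  rw [sum_congr rfl fun σ _ => by
    rw [sum_ite_eq, if_pos (mem_powersetCard.2 ⟨subset_univ _, card_map _⟩)]]
  rw [sum_const, card_univ, Fintype.card_perm, smul_eq_mul]

/-! ### Cyclic windows -/

/-- The cyclic window of length `α` that starts at `j`. -/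
def window (K α : ℕ) (j : Fin K) : Finset (Fin K) :=
  {p | (j.1 ≤ p.1 ∧ p.1 < j.1 + α) ∨ p.1 + K < j.1 + α}

/-- The positions after `j` in the window that starts at `j`, before it wraps around. -/
def windowTail (K α : ℕ) (j : Fin K) : Finset (Fin K) :=
  {p | j.1 < p.1 ∧ p.1 < j.1 + α}

theorem card_fin_filter (K : ℕ) (P : ℕ → Prop) [DecidablePred P] :
    #{p : Fin K | P p.1} = #{n ∈ range K | P n} := by
  rw [card_filter, card_filter, Fin.sum_univ_eq_sum_range (fun n => if P n then 1 else 0)]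

theorem card_window {K α : ℕ} (hα : α ≤ K) (j : Fin K) : #(window K α j) = α := by
  rw [window, card_fin_filter K (fun n => (j.1 ≤ n ∧ n < j.1 + α) ∨ n + K < j.1 + α)]
  have hj := j.2
  have : {n ∈ range K | (j.1 ≤ n ∧ n < j.1 + α) ∨ n + K < j.1 + α} =
      Ico j.1 (min (j.1 + α) K) ∪ range (j.1 + α - K) := by
    ext n
    simp only [mem_filter, mem_range, mem_union, mem_Ico]
    omega
  rw [this, card_union_of_disjoint, Nat.card_Ico, card_range]
  · omega
  · rw [disjoint_left]
    intro n
    simp only [mem_range, mem_Ico]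
    omega

theorem card_windowTail {K α : ℕ} (j : Fin K) :
    #(windowTail K α j) = min (α - 1) (K - 1 - j.1) := by
  rw [windowTail, card_fin_filter K (fun n => j.1 < n ∧ n < j.1 + α)]
  have hj := j.2
  have : {n ∈ range K | j.1 < n ∧ n < j.1 + α} = Ico (j.1 + 1) (min (j.1 + α) K) := by
    ext n
    simp only [mem_filter, mem_range, mem_Ico]
    omega
  rw [this, Nat.card_Ico]
  omega

theorem windowTail_subset (K α : ℕ) (j : Fin K) : windowTail K α j ⊆ window K α j := by
  intro p
  simp only [windowTail, window, mem_filter, mem_univ, true_and]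
  omega

theorem self_mem_window {K α : ℕ} (hα : 1 ≤ α) (j : Fin K) : j ∈ window K α j := by
  simp only [window, mem_filter, mem_univ, true_and]
  omega

/-- For `j < l`, a window from `j` that reaches `l` also contains `l - 1`, which the window from `l`
misses since `α < K`. -/
theorem window_injective {K α : ℕ} (hα : 1 ≤ α) (hαK : α < K) :
    Function.Injective (window K α) := by
  have aux : ∀ j l : Fin K, j < l → window K α j ≠ window K α l := by
    intro j l hjl h
    have hjl' : j.1 < l.1 := hjl
    have h1 := Finset.ext_iff.1 h l
    have h2 := Finset.ext_iff.1 h ⟨l.1 - 1, by omega⟩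
    simp only [window, mem_filter, mem_univ, true_and] at h1 h2
    omega
  intro j l h
  rcases lt_trichotomy j l with hlt | heq | hgt
  · exact (aux j l hlt h).elim
  · exact heq
  · exact (aux l j hgt h.symm).elim

/-- The terms with `m < α` form a hockey-stick sum; the other `K - α` are constant. -/
theorem sum_choose_min {K α : ℕ} (hα : 1 ≤ α) (hαK : α ≤ K) (t : ℕ) :
    ∑ m ∈ range K, (min (α - 1) m).choose t =
      (K - α) * (α - 1).choose t + α.choose (t + 1) := by
  induction K, hαK using Nat.le_induction with
  | base =>
    have h : ∀ n, ∑ m ∈ range n, m.choose t = n.choose (t + 1) := by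
      intro n
      induction n with
      | zero => simp
      | succ n ih => rw [sum_range_succ, ih, Nat.choose_succ_succ, add_comm]
    rw [sum_congr rfl fun m hm => by
      rw [min_eq_right (by have := mem_range.1 hm; omega)], h]
    simp
  | succ K hK ih =>
    rw [sum_range_succ, ih, min_eq_left (by omega), Nat.succ_sub hK, Nat.succ_eq_add_one]
    ring

theorem sum_choose_card_windowTail {K α : ℕ} (hα : 1 ≤ α) (hαK : α ≤ K) (t : ℕ) :
    ∑ j, (#(windowTail K α j)).choose t = (K - α) * (α - 1).choose t + α.choose (t + 1) := by
  simp only [card_windowTail]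
  rw [Fin.sum_univ_eq_sum_range (fun n => (min (α - 1) (K - 1 - n)).choose t),
    sum_range_reflect (fun m => (min (α - 1) m).choose t), sum_choose_min hα hαK]

/-- The load which each bit stored by `s` users adds, on average, to the lower bound. -/
noncomputable def loadCoeff (K α : ℕ) (s : ℝ) : ℝ := (K - α) * (1 - s / α) + (α - s) / (1 + s)

theorem sum_card_perm_window {K α : ℕ} (hα : 1 ≤ α) (hαK : α ≤ K) {S T : Finset (Fin K)}
    (hS : #S = α) (hT : T ⊆ S) :
    ((∑ j, #{σ : Equiv.Perm (Fin K) | (window K α j).map σ.toEmbedding = S ∧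
      T ⊆ (windowTail K α j).map σ.toEmbedding} : ℕ) : ℝ) * K.choose α =
        K.factorial * loadCoeff K α #T := by
  set t := #T
  have htα : t ≤ α := hS ▸ card_le_card hT
  have hnat : (∑ j, #{σ : Equiv.Perm (Fin K) | (window K α j).map σ.toEmbedding = S ∧
      T ⊆ (windowTail K α j).map σ.toEmbedding}) * (K.choose α * α.choose t) =
        K.factorial * ((K - α) * (α - 1).choose t + α.choose (t + 1)) := by
    rw [← sum_choose_card_windowTail hα hαK, sum_mul, mul_sum]
    refine sum_congr rfl fun j _ => ?_
    have := card_perm_map_mul (windowTail_subset K α j) hT (hS.trans (card_window hαK j).symm)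
    rwa [card_window hαK, Fintype.card_fin] at this
  have hreal := congrArg (Nat.cast : ℕ → ℝ) hnat
  push_cast [Nat.cast_sub hαK] at hreal
  have hα0 : (0 : ℝ) < α := by exact_mod_cast hα
  have ht0 : (0 : ℝ) < 1 + t := by positivity
  have hc0 : (0 : ℝ) < α.choose t := by exact_mod_cast Nat.choose_pos htα
  -- Both binomials are multiples of `α.choose t`, which then cancels.
  have h1 : ((α - 1).choose t : ℝ) = α.choose t * (1 - t / α) := by
    have h := Nat.choose_mul_succ_eq (α - 1) t
    rw [Nat.sub_add_cancel hα] at h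
    have h' := congrArg (Nat.cast : ℕ → ℝ) h
    push_cast [Nat.cast_sub htα] at h'
    field_simp
    linarith
  have h2 : (α.choose (t + 1) : ℝ) = α.choose t * ((α - t) / (1 + t)) := by
    have h' := congrArg (Nat.cast : ℕ → ℝ) (Nat.choose_succ_right_eq α t)
    push_cast [Nat.cast_sub htα] at h'
    field_simp
    linarith
  rw [h1, h2] at hreal
  push_cast
  refine mul_right_cancel₀ hc0.ne' ?_
  rw [loadCoeff]
  linear_combination hreal

/-! ### Averaging over orders -/

/-- The users that store the bit `b` of the file `w`. -/
def Placement.holders {K α f B : ℕ} (Z : Placement K α f B) (w : LibFile K α f) (b : Fin B) :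
    Finset (Fin K) :=
  {k | b ∈ Z.cache k w}

/-- This is where selfishness of the placement enters. -/
theorem Placement.holders_subset {K α f B : ℕ} (Z : Placement K α f B) (w : LibFile K α f)
    (b : Fin B) : Z.holders w b ⊆ w.2.1 := by
  intro k hk
  by_contra hkw
  have h : b ∈ Z.cache k w := by simpa [holders] using hk
  rw [Z.selfish k w (by simpa [fds] using hkw)] at h
  simp at h

theorem Placement.sum_card_holders {K α f B : ℕ} (Z : Placement K α f B) :
    ∑ w, ∑ b, #(Z.holders w b) = ∑ k, ∑ w, #(Z.cache k w) := by
  simp only [holders, card_filter]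
  rw [sum_comm (s := (univ : Finset (Fin K)))]
  refine sum_congr rfl fun w _ => ?_
  rw [sum_comm]
  refine sum_congr rfl fun k _ => ?_
  rw [← card_filter, filter_univ_mem]

/-- The demand in which the user at position `j` of the order `σ` requests the `i`-th file of the
class of the users in the cyclic window that starts at `j`. -/
def windowDemand {K α f : ℕ} (hαK : α ≤ K) (i : Fin f) (σ : Equiv.Perm (Fin K)) :
    Fin K → LibFile K α f :=
  fun k => (i, ⟨(window K α (σ.symm k)).map σ.toEmbedding, by rw [card_map, card_window hαK]⟩)

theorem windowDemand_valid {K α f : ℕ} (hα : 1 ≤ α) (hαK : α ≤ K) (i : Fin f)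
    (σ : Equiv.Perm (Fin K)) : ValidDemand (windowDemand hαK i σ) := by
  intro k
  simp only [fds, windowDemand, mem_filter, mem_univ, true_and, mem_map_equiv]
  exact self_mem_window hα _

theorem windowDemand_injective {K α f : ℕ} (hα : 1 ≤ α) (hαK : α < K) (i : Fin f)
    (σ : Equiv.Perm (Fin K)) : Function.Injective (windowDemand hαK.le i σ) := by
  intro k l h
  simp only [windowDemand, Prod.mk.injEq, Subtype.mk.injEq, true_and, map_inj] at h
  exact σ.symm.injective (window_injective hα hαK h)

/-- The acyclic-subgraph bound for the window demands. -/
theorem sum_card_window_le {K α f B : ℕ} (hα : 1 ≤ α) (hαK : α < K) {Z : Placement K α f B}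
    {R : ℝ} (hZ : ∀ d : Fin K → LibFile K α f, ValidDemand d →
      ∃ L : ℕ, (L : ℝ) ≤ R * B ∧ Deliverable Z d L) (i : Fin f) (σ : Equiv.Perm (Fin K)) :
    ((∑ j, #{b | Z.holders (windowDemand hαK.le i σ (σ j)) b ⊆
      (windowTail K α j).map σ.toEmbedding} : ℕ) : ℝ) ≤ R * B := by
  obtain ⟨L, hL, hdel⟩ := hZ _ (windowDemand_valid hα hαK.le i σ)
  refine le_trans ?_ hL
  have h := hdel.sum_card_le (windowDemand_injective hα hαK i σ) σ
  refine Nat.cast_le.2 (le_trans (sum_le_sum fun j _ => card_le_card fun b hb => ?_) h)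
  simp only [mem_filter, mem_univ, true_and] at hb ⊢
  intro l hl hbl
  have hmem : σ l ∈ Z.holders (windowDemand hαK.le i σ (σ j)) b := by
    simpa [Placement.holders] using hbl
  have := hb hmem
  simp only [mem_map_equiv, Equiv.symm_apply_apply, windowTail, mem_filter, mem_univ,
    true_and] at this
  exact absurd this.1 (not_lt.2 hl)

/-- The converse bound before Jensen's inequality: an average over all orders of the users. -/
theorem sum_loadCoeff_le {K α f B : ℕ} (hα : 1 ≤ α) (hαK : α < K) {Z : Placement K α f B}
    {R : ℝ} (hZ : ∀ d : Fin K → LibFile K α f, ValidDemand d →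
      ∃ L : ℕ, (L : ℝ) ≤ R * B ∧ Deliverable Z d L) :
    ∑ w, ∑ b, loadCoeff K α #(Z.holders w b) ≤ numFiles K α f * (R * B) := by
  have htotal : (((∑ i : Fin f, ∑ σ : Equiv.Perm (Fin K), ∑ j,
      #{b | Z.holders (windowDemand hαK.le i σ (σ j)) b ⊆
        (windowTail K α j).map σ.toEmbedding} : ℕ)) : ℝ) ≤ f * (K.factorial * (R * B)) := by
    rw [Nat.cast_sum]
    refine (sum_le_card_nsmul _ _ (K.factorial * (R * B)) fun i _ => ?_).trans_eq (by simp)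
    rw [Nat.cast_sum]
    refine (sum_le_card_nsmul _ _ (R * B) fun σ _ => sum_card_window_le hα hαK hZ i σ).trans_eq ?_
    rw [card_univ, Fintype.card_perm, Fintype.card_fin, nsmul_eq_mul]
  have hcount : (∑ i : Fin f, ∑ σ : Equiv.Perm (Fin K), ∑ j,
      #{b | Z.holders (windowDemand hαK.le i σ (σ j)) b ⊆
        (windowTail K α j).map σ.toEmbedding}) =
      ∑ w : LibFile K α f, ∑ b, ∑ j, #{σ : Equiv.Perm (Fin K) |
        (window K α j).map σ.toEmbedding = w.2.1 ∧
          Z.holders w b ⊆ (windowTail K α j).map σ.toEmbedding} := by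
    rw [Fintype.sum_prod_type]
    refine sum_congr rfl fun i _ => ?_
    simp only [card_filter]
    -- Only one class equals the given window, so the indicator spreads over all classes and the
    -- sums can be exchanged.
    have hσ : ∀ (σ : Equiv.Perm (Fin K)) (j : Fin K) (b : Fin B),
        (if Z.holders (windowDemand hαK.le i σ (σ j)) b ⊆
          (windowTail K α j).map σ.toEmbedding then 1 else 0) =
        ∑ S : {S : Finset (Fin K) // S.card = α},
          if (window K α j).map σ.toEmbedding = S.1 ∧
            Z.holders (i, S) b ⊆ (windowTail K α j).map σ.toEmbedding then 1 else 0 := by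
      intro σ j b
      rw [sum_eq_single (windowDemand hαK.le i σ (σ j)).2]
      · simp [windowDemand]
      · intro S _ hS
        refine if_neg fun h => hS (Subtype.ext ?_)
        simpa [windowDemand] using h.1.symm
      · simp
    simp only [hσ]
    rw [sum_comm, sum_congr rfl fun j _ => sum_comm]
    rw [sum_congr rfl fun j _ => sum_congr rfl fun b _ => sum_comm, sum_comm]
    rw [sum_congr rfl fun b _ => sum_comm, sum_comm]
  have hK : (0 : ℝ) < K.factorial := by exact_mod_cast K.factorial_pos
  have hmul : (K.factorial : ℝ) * ∑ w, ∑ b, loadCoeff K α #(Z.holders w b) ≤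
      K.factorial * (numFiles K α f * (R * B)) := by
    calc (K.factorial : ℝ) * ∑ w, ∑ b, loadCoeff K α #(Z.holders w b)
        = ((∑ w : LibFile K α f, ∑ b, ∑ j, #{σ : Equiv.Perm (Fin K) |
            (window K α j).map σ.toEmbedding = w.2.1 ∧
              Z.holders w b ⊆ (windowTail K α j).map σ.toEmbedding} : ℕ) : ℝ) * K.choose α := by
          rw [Nat.cast_sum, sum_mul, mul_sum]
          refine sum_congr rfl fun w _ => ?_
          rw [Nat.cast_sum, sum_mul, mul_sum]
          refine sum_congr rfl fun b _ => ?_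
          exact (sum_card_perm_window hα hαK.le w.2.2 (Z.holders_subset w b)).symm
      _ ≤ f * (K.factorial * (R * B)) * K.choose α := by
          rw [← hcount]
          exact mul_le_mul_of_nonneg_right htotal (Nat.cast_nonneg _)
      _ = K.factorial * (numFiles K α f * (R * B)) := by
          rw [numFiles]
          push_cast
          ring
  exact le_of_mul_le_mul_left hmul hK

/-! ### Convexity and the memory constraint -/

/-- `loadCoeff` lies above its tangents. -/
theorem loadCoeff_tangent_le {K α : ℕ} (hα : 1 ≤ α) {s t : ℝ} (hs : 0 ≤ s) (ht : 0 ≤ t) :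
    loadCoeff K α t - ((K - α) / α + (α + 1) / (1 + t) ^ 2) * (s - t) ≤ loadCoeff K α s := by
  have hα0 : (0 : ℝ) < α := by exact_mod_cast hα
  have hdiff : loadCoeff K α s - (loadCoeff K α t -
      ((K - α) / α + (α + 1) / (1 + t) ^ 2) * (s - t)) =
        (α + 1) * (s - t) ^ 2 / ((1 + s) * (1 + t) ^ 2) := by
    have : 1 + s ≠ 0 := by positivity
    have : 1 + t ≠ 0 := by positivity
    rw [loadCoeff, loadCoeff]
    field_simp
    ring
  have : (0 : ℝ) ≤ (α + 1) * (s - t) ^ 2 / ((1 + s) * (1 + t) ^ 2) := by positivity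
  linarith

theorem Achievable.loadCoeff_le {K α f : ℕ} {M R : ℝ} (hα : 1 ≤ α) (hαK : α < K) (hf : 1 ≤ f)
    (hM : 0 ≤ M) (h : Achievable K α f M R) : loadCoeff K α (K * gam K α f M) ≤ R := by
  obtain ⟨B, hB, Z, hfit, hZ⟩ := h
  have hsum := sum_loadCoeff_le hα hαK hZ
  have hN : (0 : ℝ) < numFiles K α f := by
    exact_mod_cast Nat.mul_pos hf (Nat.choose_pos hαK.le)
  have hB0 : (0 : ℝ) < B := by exact_mod_cast hB
  have hα0 : (0 : ℝ) < α := by exact_mod_cast hα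
  have hKα : (0 : ℝ) ≤ K - α := by
    have : (α : ℝ) ≤ K := by exact_mod_cast hαK.le
    linarith
  set t : ℝ := K * gam K α f M with ht
  have ht0 : 0 ≤ t := mul_nonneg (Nat.cast_nonneg _) (div_nonneg hM hN.le)
  -- `-c` is the slope at `t`; as `c ≥ 0`, an upper bound on the total number of stored copies
  -- suffices.
  set c : ℝ := (K - α) / α + (α + 1) / (1 + t) ^ 2 with hc
  have hc0 : 0 ≤ c := by positivity
  have hmem : ∑ w, ∑ b, (#(Z.holders w b) : ℝ) ≤ numFiles K α f * B * t := by
    have h1 : ∑ w, ∑ b, (#(Z.holders w b) : ℝ) =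
        ∑ k, ((∑ w, #(Z.cache k w) : ℕ) : ℝ) := by
      exact_mod_cast Z.sum_card_holders
    rw [h1]
    refine (sum_le_card_nsmul _ _ _ fun k _ => hfit k).trans_eq ?_
    rw [card_univ, Fintype.card_fin, nsmul_eq_mul, ht, gam]
    field_simp
  have hlow : ∑ w : LibFile K α f, ∑ b, (loadCoeff K α t - c * (#(Z.holders w b) - t)) ≤
      ∑ w, ∑ b, loadCoeff K α #(Z.holders w b) :=
    sum_le_sum fun w _ => sum_le_sum fun b _ =>
      loadCoeff_tangent_le hα (Nat.cast_nonneg _) ht0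
  have heq : ∑ w : LibFile K α f, ∑ b, (loadCoeff K α t - c * (#(Z.holders w b) - t)) =
      numFiles K α f * B * (loadCoeff K α t + c * t) -
        c * ∑ w, ∑ b, (#(Z.holders w b) : ℝ) := by
    have : ∀ (w : LibFile K α f) (b : Fin B), loadCoeff K α t - c * (#(Z.holders w b) - t) =
        (loadCoeff K α t + c * t) - c * #(Z.holders w b) := fun w b => by ring
    simp only [this, sum_sub_distrib, ← mul_sum, sum_const, card_univ, card_libFile,
      Fintype.card_fin, nsmul_eq_mul]
    ring
  have hfin : numFiles K α f * B * loadCoeff K α t ≤ numFiles K α f * B * R := by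
    have := mul_le_mul_of_nonneg_left hmem hc0
    linarith
  exact le_of_mul_le_mul_left hfin (by positivity)

/-- Without caching, the server can broadcast the whole library. -/
theorem achievable_numFiles (K α f : ℕ) {M : ℝ} (hM : 0 ≤ M) :
    Achievable K α f M (numFiles K α f) := by
  refine ⟨1, one_pos, ⟨fun _ _ => ∅, fun _ _ _ => rfl⟩, fun k => by simpa using hM,
    fun d _ => ⟨numFiles K α f, by simp, ?_⟩⟩
  let e : LibFile K α f ≃ Fin (numFiles K α f) := Fintype.equivFinOfCardEq (card_libFile K α f)
  refine ⟨fun W n => W (e.symm n) 0, fun k x _ _ => x (e (d k)), fun W k => ?_⟩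
  funext b
  rw [Subsingleton.elim b 0]
  simp

theorem loadCoeff_le_optimalLoad {K α f : ℕ} {M : ℝ} (hα : 1 ≤ α) (hαK : α < K) (hf : 1 ≤ f)
    (hM : 0 ≤ M) : loadCoeff K α (K * gam K α f M) ≤ optimalLoad K α f M :=
  -- Nonemptiness matters: the real `sInf` of the empty set is `0`.
  le_csInf ⟨_, achievable_numFiles K α f hM⟩ fun _ hR => hR.loadCoeff_le hα hαK hf hM

/-! ### From the load to the gain -/

theorem mul_gam_eq {K α f : ℕ} (M : ℝ) (hα : 1 ≤ α) (hαK : α ≤ K) (hf : 1 ≤ f) :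
    K * gam K α f M = α * gamEff K α f M := by
  have h := Nat.add_one_mul_choose_eq (K - 1) (α - 1)
  rw [Nat.sub_add_cancel hα, Nat.sub_add_cancel (hα.trans hαK)] at h
  have h' := congrArg (Nat.cast : ℕ → ℝ) h
  push_cast at h'
  have h1 : (0 : ℝ) < K.choose α := by exact_mod_cast Nat.choose_pos hαK
  have h2 : (0 : ℝ) < (K - 1).choose (α - 1) := by
    exact_mod_cast Nat.choose_pos (Nat.sub_le_sub_right hαK 1)
  have hf0 : (0 : ℝ) < f := by exact_mod_cast hf
  rw [gam, gamEff, numFiles, fdsSize]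
  push_cast
  field_simp
  linear_combination M * h'

theorem codingGain_bounds {K α f : ℕ} {M : ℝ} (hα : 1 ≤ α) (hαK : α < K) (hf : 1 ≤ f)
    (hM : 0 ≤ M) (hMF : M < fdsSize K α f) :
    0 < optimalLoad K α f M ∧
      codingGain K α f M ≤ (K * gam K α f M + 1) / (((K : ℝ) - α) * gam K α f M + 1) ∧
      (K * gam K α f M + 1) / (((K : ℝ) - α) * gam K α f M + 1) < 1 / (1 - (α : ℝ) / K) := by
  have hopt := loadCoeff_le_optimalLoad hα hαK hf hM
  have hα0 : (0 : ℝ) < α := by exact_mod_cast hα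
  have hKα : (0 : ℝ) < K - α := by
    have : (α : ℝ) < K := by exact_mod_cast hαK
    linarith
  have hK0 : (0 : ℝ) < K := by linarith
  have hγ0 : 0 ≤ gam K α f M := div_nonneg hM (Nat.cast_nonneg _)
  have heff : gamEff K α f M < 1 := (div_lt_one (hM.trans_lt hMF)).2 hMF
  have hγ := mul_gam_eq (f := f) M hα hαK.le hf
  have hU : 0 < uncodedLoad K α f M := mul_pos hK0 (by linarith)
  set γ := gam K α f M
  have hn : 0 < K * γ + 1 := by positivity
  have hd : 0 < ((K : ℝ) - α) * γ + 1 := by positivity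
  have hcoeff : loadCoeff K α (K * γ) =
      uncodedLoad K α f M * ((((K : ℝ) - α) * γ + 1) / (K * γ + 1)) := by
    have heff' : gamEff K α f M = K * γ / α := by rw [hγ]; field_simp
    have : 1 + K * γ ≠ 0 := by positivity
    rw [loadCoeff, uncodedLoad, heff']
    field_simp
    ring
  rw [hcoeff] at hopt
  have hpos : 0 < optimalLoad K α f M := lt_of_lt_of_le (by positivity) hopt
  refine ⟨hpos, ?_, ?_⟩
  · rw [codingGain, div_le_div_iff₀ hpos hd]
    rw [mul_div_assoc', div_le_iff₀ hn] at hopt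
    linarith
  · have : 1 - (α : ℝ) / K = (K - α) / K := by field_simp
    rw [this, one_div_div, div_lt_div_iff₀ hd hKα]
    -- After cross-multiplication only `K - α < K` remains.
    linear_combination hα0

end SelfishCaching

theorem corollary2 (δ : ℝ) (hδ : δ < 1) :
    (∀ (K α f : ℕ) (M : ℝ), 1 ≤ α → α ≤ K → 1 ≤ f → (α : ℝ) / K = δ →
      0 ≤ M → M < SelfishCaching.fdsSize K α f →
        0 < SelfishCaching.optimalLoad K α f M ∧
        SelfishCaching.codingGain K α f M ≤
          (K * SelfishCaching.gam K α f M + 1) /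
            (((K : ℝ) - α) * SelfishCaching.gam K α f M + 1) ∧
        (K * SelfishCaching.gam K α f M + 1) /
            (((K : ℝ) - α) * SelfishCaching.gam K α f M + 1) < 1 / (1 - δ)) ∧
    ∃ C : ℝ, ∀ (K α f : ℕ) (M : ℝ), 1 ≤ α → α ≤ K → 1 ≤ f → (α : ℝ) / K = δ →
      0 ≤ M → M < SelfishCaching.fdsSize K α f → SelfishCaching.codingGain K α f M ≤ C := by
  have key : ∀ (K α f : ℕ) (M : ℝ), 1 ≤ α → α ≤ K → 1 ≤ f → (α : ℝ) / K = δ →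
      0 ≤ M → M < SelfishCaching.fdsSize K α f →
        0 < SelfishCaching.optimalLoad K α f M ∧
        SelfishCaching.codingGain K α f M ≤
          (K * SelfishCaching.gam K α f M + 1) /
            (((K : ℝ) - α) * SelfishCaching.gam K α f M + 1) ∧
        (K * SelfishCaching.gam K α f M + 1) /
            (((K : ℝ) - α) * SelfishCaching.gam K α f M + 1) < 1 / (1 - δ) := by
    rintro K α f M hα hαK hf rfl hM hMF
    have hK0 : (0 : ℝ) < K := by exact_mod_cast hα.trans hαK
    -- `δ < 1` excludes `α = K`, where all windows would coincide.
    have hlt : α < K := by exact_mod_cast (div_lt_one hK0).1 hδ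
    exact SelfishCaching.codingGain_bounds hα hlt hf hM hMF
  refine ⟨key, 1 / (1 - δ), fun K α f M hα hαK hf hr hM hMF => ?_⟩
  obtain ⟨-, h1, h2⟩ := key K α f M hα hαK hf hr hM hMF
  exact h1.trans h2.le
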